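/- For a compact Hausdorff space $X$ let $C(X,[0,1])$ be the set of continuous functions $X\to[0,1]$. A functional $\mu:C(X,[0,1])\to[0,1]$ is called a $\cdot$-measure if $\mu(1_X)=1$, $\mu(\lambda_X\cdot\varphi)=\lambda\cdot\mu(\varphi)$ for all $\lambda\in[0,1]$ and $\varphi\in C(X,[0,1])$, and $\mu(\psi\vee\varphi)=\mu(\psi)\vee\mu(\varphi)$ for all $\psi,\varphi\in C(X,[0,1])$; here $c_X$ is the constant function with value $c$ and $\vee$ is the (pointwise) maximum. Let $A^\cdot(X)$ be the set of all $\cdot$-measures on $X$, with the topology of a subspace of the product $[0,1]^{C(X,[0,1])}$. Proposition. Let $a,b\in(0,1]$, let $T$ be a set of arbitrary cardinality $\tau$, and let $P=[a,b]^T\subset[0,1]^T$ have the product topology. For $\mu\in A^\cdot(P)$ let $\beta^\cdot_P(\mu)$ be the point whose $t$-th coordinate is $\mu(\mathrm{pr}_t|_P)$, $t\in T$, where $\mathrm{pr}_t:[0,1]^T\to[0,1]$ is the projection; this point lies in $P$. Then the max-$\cdot$ barycenter map $\beta^\cdot_P:A^\cdot(P)\to P$ is open. -/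

import Mathlib

namespace MaxDot

open scoped unitInterval

/-- A functional `μ : C(X, [0,1]) → [0,1]` is a `·`-measure if it is normed, homogeneous for
multiplication by constants from `[0,1]`, and preserves pointwise maxima. -/
structure IsDotMeasure {X : Type*} [TopologicalSpace X] (μ : C(X, I) → I) : Prop where
  map_one : μ (ContinuousMap.const X 1) = 1
  map_const_mul : ∀ (c : I) (φ : C(X, I)), μ (ContinuousMap.const X c * φ) = c * μ φ
  map_max : ∀ ψ φ : C(X, I), μ (ψ ⊔ φ) = μ ψ ⊔ μ φ

/-- The space of `·`-measures on `X`, with the topology of a subspace of the product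
`[0,1]^C(X,[0,1])`. -/
abbrev DotMeasure (X : Type*) [TopologicalSpace X] : Type _ :=
  {μ : C(X, I) → I // IsDotMeasure μ}

/-- The coordinate function `K → [0,1]`, `x ↦ x t`, on a subset `K` of `[0,1]^T`. -/
def coord {T : Type*} (K : Set (T → I)) (t : T) : C(K, I) where
  toFun x := x.1 t
  continuous_toFun := (continuous_apply t).comp continuous_subtype_val

/-- The point of `[0,1]^T` whose `t`-th coordinate is the value of `μ` at the `t`-th coordinate
function of `K`. -/
def barycenterPoint {T : Type*} (K : Set (T → I)) (μ : DotMeasure K) : T → I :=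
  fun t => μ.1 (coord K t)

/-- The max-`·` barycenter map of `K`, for a set `K` which contains the barycenters of all
`·`-measures on `K`. -/
def barycenterMap {T : Type*} (K : Set (T → I)) (hK : ∀ μ : DotMeasure K, barycenterPoint K μ ∈ K) :
    DotMeasure K → K :=
  fun μ => ⟨barycenterPoint K μ, hK μ⟩

/-- The cube `[a,b]^T` as a subset of `[0,1]^T`. -/
def cube (T : Type*) (a b : ℝ) : Set (T → I) :=
  {x | ∀ t, (x t : ℝ) ∈ Set.Icc a b}

theorem IsDotMeasure.mono {X : Type*} [TopologicalSpace X] {μ : C(X, I) → I}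
    (hμ : IsDotMeasure μ) {φ ψ : C(X, I)} (h : φ ≤ ψ) : μ φ ≤ μ ψ := by
  have h1 := hμ.map_max φ ψ
  rw [sup_eq_right.mpr h] at h1
  exact sup_eq_right.mp h1.symm

theorem IsDotMeasure.map_const {X : Type*} [TopologicalSpace X] {μ : C(X, I) → I}
    (hμ : IsDotMeasure μ) (c : I) : μ (ContinuousMap.const X c) = c := by
  have h1 := hμ.map_const_mul c (ContinuousMap.const X 1)
  rw [hμ.map_one, mul_one] at h1
  rwa [show ContinuousMap.const X c * ContinuousMap.const X 1 = ContinuousMap.const X c by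
    ext x; simp] at h1

/-- The cube contains the barycenters of all `·`-measures on it. -/
theorem barycenterPoint_mem_cube (T : Type*) (a b : ℝ) (ha : a ∈ Set.Ioc (0 : ℝ) 1)
    (hb : b ∈ Set.Ioc (0 : ℝ) 1) (μ : DotMeasure (cube T a b)) :
    barycenterPoint (cube T a b) μ ∈ cube T a b := by
  intro t
  constructor
  · have h := μ.2.mono (φ := ContinuousMap.const _ (⟨a, ha.1.le, ha.2⟩ : I))
      (ψ := coord (cube T a b) t) (fun x => (x.2 t).1)
    rw [μ.2.map_const] at h
    exact h
  · have h := μ.2.mono (ψ := ContinuousMap.const _ (⟨b, hb.1.le, hb.2⟩ : I))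
      (φ := coord (cube T a b) t) (fun x => (x.2 t).2)
    rw [μ.2.map_const] at h
    exact h

end MaxDot

namespace MaxDot

open scoped unitInterval Topology
open Filter

/-! ### Max-times measures and the scaled Diracs below them. -/

section Measures

variable {X Y : Type*} [TopologicalSpace X] [TopologicalSpace Y]

/-! Openness comes from continuous sections. Given `μ` with barycenter `x` and a finite set `S` of
coordinates, `exists_section` gives a continuous right inverse of the barycenter map sending `x` to
the image of `μ` under `freeze x S`. As `S` grows, these images tend to `μ` (`tendsto_comp_freeze`),
so every neighbourhood of `μ` is entered by some section at `x`, hence at all points near `x`. The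
section pushes `μ` forward by a map depending on `y` so that no coordinate of the barycenter exceeds
that of `y`, then joins finitely many scaled Diracs that restore the coordinates in `S`. These
Diracs come from `exists_mul_apply_eq`. -/

/-- A `·`-measure is a maximum of scaled point evaluations lying below it. -/
theorem IsDotMeasure.exists_mul_apply_eq [CompactSpace X] {μ : C(X, I) → I}
    (hμ : IsDotMeasure μ) (φ : C(X, I)) (hφ : 0 < μ φ) :
    ∃ z : X, ∃ c : I, c * φ z = μ φ ∧ ∀ ψ : C(X, I), c * ψ z ≤ μ ψ := by
  have hm : (0 : ℝ) < μ φ := hφ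
  have key : ∃ z : X, ∀ ψ : C(X, I), (μ φ : ℝ) * ψ z ≤ φ z * μ ψ := by
    by_contra! hcon
    -- Compactness turns pointwise failure into a single `ψ` that contradicts monotonicity and
    -- homogeneity.
    have hcover : ∃ (δ : I) (ψ : C(X, I)), 0 < (δ : ℝ) ∧
        (∀ z ∈ (Set.univ : Set X), (δ : ℝ) * φ z ≤ ψ z) ∧ (μ ψ : ℝ) < δ * μ φ := by
      refine isCompact_univ.induction_on (p := fun s => ∃ (δ : I) (ψ : C(X, I)), 0 < (δ : ℝ) ∧
        (∀ z ∈ s, (δ : ℝ) * φ z ≤ ψ z) ∧ (μ ψ : ℝ) < δ * μ φ) ?_ ?_ ?_ ?_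
      · refine ⟨1, ContinuousMap.const X 0, by simp, by simp, ?_⟩
        rw [hμ.map_const]
        simpa using hm
      · rintro s t hst ⟨δ, ψ, h0, h1, h2⟩
        exact ⟨δ, ψ, h0, fun z hz => h1 z (hst hz), h2⟩
      · rintro s t ⟨δ, ψ, h0, h1, h2⟩ ⟨δ', ψ', h0', h1', h2'⟩
        refine ⟨δ * δ', (ContinuousMap.const X δ' * ψ) ⊔ (ContinuousMap.const X δ * ψ'),
          by simpa using mul_pos h0 h0', ?_, ?_⟩
        · rintro z (hz | hz)
          · have h : δ * δ' * φ z ≤ δ' * ψ z := by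
              rw [← Subtype.coe_le_coe]
              push_cast
              nlinarith [h1 z hz]
            exact h.trans le_sup_left
          · have h : δ * δ' * φ z ≤ δ * ψ' z := by
              rw [← Subtype.coe_le_coe]
              push_cast
              nlinarith [h1' z hz]
            exact h.trans le_sup_right
        · rw [hμ.map_max, hμ.map_const_mul, hμ.map_const_mul]
          have h : δ' * μ ψ ⊔ δ * μ ψ' < δ * δ' * μ φ := by
            refine sup_lt_iff.2 ⟨?_, ?_⟩ <;> rw [← Subtype.coe_lt_coe] <;> push_cast <;> nlinarith
          exact h
      · intro z _
        obtain ⟨ψ, hψ⟩ := hcon z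
        have hφz : (0 : ℝ) ≤ φ z := (φ z).2.1
        have hlim : ∀ᶠ u : ℝ in 𝓝[>] (μ ψ : ℝ), (φ z : ℝ) * u < μ φ * ψ z ∧ u < 2 := by
          refine nhdsWithin_le_nhds (Filter.Eventually.and ?_ ?_)
          · exact (continuous_const.mul continuous_id).continuousAt.eventually_lt
              continuousAt_const hψ
          · exact eventually_lt_nhds ((μ ψ).2.2.trans_lt one_lt_two)
        obtain ⟨u, ⟨hu, hu2⟩, huμ⟩ := (hlim.and self_mem_nhdsWithin).exists
        have hu0 : 0 < u := (μ ψ).2.1.trans_lt huμ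
        -- Since `u` may exceed 1, everything is halved to keep the scalars in `I`.
        let h : I := ⟨1 / 2, by norm_num, by norm_num⟩
        let δ : I := ⟨u / 2, by linarith, by linarith⟩
        have hopen : IsOpen {x : X | (φ x : ℝ) * u < μ φ * ψ x} :=
          isOpen_lt (by fun_prop) (by fun_prop)
        refine ⟨_, nhdsWithin_le_nhds (hopen.mem_nhds hu), δ,
          ContinuousMap.const X (h * μ φ) * ψ, half_pos hu0, ?_, ?_⟩
        · intro x hx
          rw [Set.mem_ofPred_eq] at hx
          change u / 2 * (φ x : ℝ) ≤ 1 / 2 * (μ φ : ℝ) * ψ x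
          linarith
        · rw [hμ.map_const_mul]
          change 1 / 2 * (μ φ : ℝ) * μ ψ < u / 2 * μ φ
          nlinarith
    obtain ⟨δ, ψ, -, h1, h2⟩ := hcover
    have h3 : μ (ContinuousMap.const X δ * φ) ≤ μ ψ := hμ.mono fun z => h1 z trivial
    rw [hμ.map_const_mul] at h3
    exact absurd (show (δ : ℝ) * μ φ ≤ μ ψ from h3) (not_le.2 h2)
  obtain ⟨z, hz⟩ := key
  have h1 : (μ φ : ℝ) ≤ φ z := by
    have := hz (ContinuousMap.const X 1)
    rw [hμ.map_one] at this
    simpa using this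
  have hφz : (0 : ℝ) < φ z := hm.trans_le h1
  refine ⟨z, ⟨μ φ / φ z, by positivity, (div_le_one hφz).2 h1⟩, ?_, fun ψ => ?_⟩
  · apply Subtype.ext
    change (μ φ : ℝ) / φ z * φ z = μ φ
    field_simp
  · change (μ φ : ℝ) / φ z * ψ z ≤ μ ψ
    rw [div_mul_eq_mul_div, div_le_iff₀ hφz, mul_comm (μ ψ : ℝ)]
    exact hz ψ

/-- A scaled Dirac attaining `μ φ` has weight at most 1, so it is 1-Lipschitz, and it bounds `μ ψ`
from below. -/
theorem IsDotMeasure.sub_le_dist [CompactSpace X] {μ : C(X, I) → I} (hμ : IsDotMeasure μ)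
    (φ ψ : C(X, I)) : (μ φ : ℝ) - μ ψ ≤ dist φ ψ := by
  rcases (μ φ).2.1.eq_or_lt with h | h
  · rw [← h]
    linarith [(μ ψ).2.1, dist_nonneg (x := φ) (y := ψ)]
  · obtain ⟨z, c, hc, hle⟩ := hμ.exists_mul_apply_eq φ h
    have h1 : (c : ℝ) * ψ z ≤ μ ψ := hle ψ
    have h2 : (φ z : ℝ) - ψ z ≤ dist φ ψ :=
      (le_abs_self _).trans (ContinuousMap.dist_apply_le_dist (f := φ) (g := ψ) z)
    have h3 : (c : ℝ) * ((φ z : ℝ) - ψ z) ≤ 1 * dist φ ψ :=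
      (mul_le_mul_of_nonneg_left h2 c.2.1).trans
        (mul_le_mul_of_nonneg_right c.2.2 dist_nonneg)
    rw [← hc]
    push_cast
    linarith

theorem IsDotMeasure.continuous [CompactSpace X] {μ : C(X, I) → I} (hμ : IsDotMeasure μ) :
    Continuous μ := by
  refine (LipschitzWith.of_dist_le_mul (K := 1) fun φ ψ => ?_).continuous
  rw [NNReal.coe_one, one_mul, Subtype.dist_eq, Real.dist_eq]
  refine abs_sub_le_iff.2 ⟨hμ.sub_le_dist φ ψ, ?_⟩
  rw [dist_comm]
  exact hμ.sub_le_dist ψ φ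

theorem IsDotMeasure.map {μ : C(X, I) → I} (hμ : IsDotMeasure μ) (f : C(X, Y)) :
    IsDotMeasure fun φ : C(Y, I) => μ (φ.comp f) where
  map_one := hμ.map_one
  map_const_mul c φ := hμ.map_const_mul c (φ.comp f)
  map_max ψ φ := hμ.map_max (ψ.comp f) (φ.comp f)

theorem IsDotMeasure.sup_dirac {μ : C(X, I) → I} (hμ : IsDotMeasure μ) {ι : Type*}
    (S : Finset ι) (c : ι → I) (w : ι → X) :
    IsDotMeasure fun φ : C(X, I) => μ φ ⊔ S.sup fun t => c t * φ (w t) where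
  map_one := by
    rw [hμ.map_one]
    exact sup_eq_left.2 le_top
  map_const_mul k φ := by
    have hmono : Monotone fun x : I => k * x := fun x y h => mul_le_mul_right h k
    rw [hμ.map_const_mul, hmono.map_sup,
      Finset.apply_sup_eq_sup_comp_of_linearOrder (fun x : I => k * x) hmono (mul_zero k)]
    congr 2
    funext t
    simp [mul_left_comm]
  map_max ψ φ := by
    have hmul : ∀ t, c t * (ψ ⊔ φ) (w t) = c t * ψ (w t) ⊔ c t * φ (w t) := fun t =>
      (show Monotone fun x : I => c t * x from fun x y h => mul_le_mul_right h _).map_sup _ _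
    simp only [hmul]
    rw [hμ.map_max]
    refine (congrArg (μ ψ ⊔ μ φ ⊔ ·) Finset.sup_sup).trans ?_
    exact sup_sup_sup_comm _ _ _ _

end Measures

/-! ### Sections of the barycenter map on the cube. -/

section Cube

variable {T : Type*} {a b : ℝ}

instance (T : Type*) (a b : ℝ) : CompactSpace (cube T a b) := by
  refine isCompact_iff_compactSpace.1 (IsClosed.isCompact ?_)
  simp only [cube, Set.ofPred_forall]
  exact isClosed_iInter fun t => isClosed_Icc.preimage (by fun_prop)

theorem subsingleton_cube (h : b < a) : Subsingleton (cube T a b) :=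
  ⟨fun x _ => Subtype.ext <| funext fun t =>
    absurd ((x.2 t).1.trans (x.2 t).2) (not_le.2 h)⟩

/-- The point of the cube obtained by clamping all coordinates to `[a,b]`. -/
def clamp (ha : 0 ≤ a) (hb : b ≤ 1) (hab : a ≤ b) (g : T → ℝ) : cube T a b :=
  ⟨fun t => ⟨max a (min b (g t)), ha.trans (le_max_left _ _),
    max_le (hab.trans hb) ((min_le_left _ _).trans hb)⟩,
    fun _ => ⟨le_max_left _ _, max_le hab (min_le_left _ _)⟩⟩

theorem clamp_apply (ha : 0 ≤ a) (hb : b ≤ 1) (hab : a ≤ b) (g : T → ℝ) (t : T) :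
    (((clamp ha hb hab g).1 t : I) : ℝ) = max a (min b (g t)) := rfl

theorem clamp_apply_of_mem (ha : 0 ≤ a) (hb : b ≤ 1) (hab : a ≤ b) {g : T → ℝ} {t : T}
    (h : g t ∈ Set.Icc a b) : (((clamp ha hb hab g).1 t : I) : ℝ) = g t := by
  rw [clamp_apply, min_eq_right h.2, max_eq_right h.1]

theorem continuous_clamp_comp {Z : Type*} [TopologicalSpace Z] (ha : 0 ≤ a) (hb : b ≤ 1)
    (hab : a ≤ b) {g : Z → T → ℝ} (hg : ∀ t, Continuous fun z => g z t) :
    Continuous fun z => clamp ha hb hab (g z) := by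
  refine Continuous.subtype_mk (continuous_pi fun t => Continuous.subtype_mk ?_ _) _
  have := hg t
  fun_prop

theorem continuous_cube_apply (t : T) : Continuous fun x : cube T a b => ((x.1 t : I) : ℝ) :=
  continuous_subtype_val.comp ((continuous_apply t).comp continuous_subtype_val)

open Classical in
/-- Replacing the coordinates outside `S` by those of `x`. -/
noncomputable def freeze (x : cube T a b) (S : Finset T) : C(cube T a b, cube T a b) where
  toFun z := ⟨fun t => if t ∈ S then z.1 t else x.1 t, fun t => by
    beta_reduce
    split_ifs
    exacts [z.2 t, x.2 t]⟩
  continuous_toFun := by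
    refine Continuous.subtype_mk (continuous_pi fun t => ?_) _
    split_ifs
    exacts [(continuous_apply t).comp continuous_subtype_val, continuous_const]

open Classical in
theorem freeze_apply (x : cube T a b) (S : Finset T) (z : cube T a b) (t : T) :
    (freeze x S z).1 t = if t ∈ S then z.1 t else x.1 t := rfl

/-- `freeze x S` tends uniformly to the identity, because the product uniformity sees one coordinate
at a time and each is eventually left unchanged. -/
theorem tendsto_comp_freeze (x : cube T a b) (φ : C(cube T a b, I)) :
    Tendsto (fun S : Finset T => φ.comp (freeze x S)) atTop (𝓝 φ) := by
  classical
  rw [ContinuousMap.tendsto_iff_tendstoUniformly]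
  refine (CompactSpace.uniformContinuous_of_continuous φ.continuous).comp_tendstoUniformly
    (g := φ) (F := fun S z => freeze x S z) (f := id) ?_
  rw [tendstoUniformly_iff_tendsto, uniformity_subtype, Pi.uniformity, tendsto_comap_iff,
    tendsto_iInf]
  intro t
  rw [tendsto_comap_iff]
  refine Tendsto.mono_right ?_ (refl_le_uniformity (α := I))
  rw [tendsto_principal]
  have : ∀ᶠ S : Finset T in atTop, t ∈ S := by
    filter_upwards [eventually_ge_atTop {t}] with S hS
    exact hS (Finset.mem_singleton_self t)
  filter_upwards [this.prod_inl (⊤ : Filter (cube T a b))] with p hp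
  simp [freeze_apply, hp]

theorem exists_section (ha : 0 < a) (hb : b ≤ 1) (hab : a ≤ b) (μ : DotMeasure (cube T a b))
    (x : cube T a b) (hx : barycenterPoint (cube T a b) μ = x.1) (S : Finset T) :
    ∃ ρ : cube T a b → DotMeasure (cube T a b), Continuous ρ ∧
      (∀ y, barycenterPoint (cube T a b) (ρ y) = y.1) ∧
      ∀ φ, (ρ x).1 φ = μ.1 (φ.comp (freeze x S)) := by
  classical
  have hb0 : 0 < b := ha.trans_le hab
  have hxt : ∀ t, μ.1 (coord (cube T a b) t) = x.1 t := fun t => congrFun hx t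
  have hpos : ∀ (y : cube T a b) t, (0 : ℝ) < y.1 t := fun y t => ha.trans_le (y.2 t).1
  have hrep : ∀ t, ∃ z : cube T a b, ∃ c : I, c * z.1 t = x.1 t ∧
      ∀ ψ : C(cube T a b, I), c * ψ z ≤ μ.1 ψ := fun t => by
    have := μ.2.exists_mul_apply_eq (coord (cube T a b) t) (by
      rw [hxt t]
      exact hpos x t)
    rwa [hxt t] at this
  choose z c hcz hcle using hrep
  have hczR : ∀ t, (c t : ℝ) * (z t).1 t = x.1 t := fun t => by
    simpa using congrArg Subtype.val (hcz t)
  have hc0 : ∀ t, (0 : ℝ) < c t := fun t => by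
    have h := hpos x t
    rw [← hczR t] at h
    exact pos_of_mul_pos_left h (hpos _ _).le
  have hcx : ∀ t s, (c t : ℝ) * (z t).1 s ≤ x.1 s := fun t s => by
    have := hcle t (coord (cube T a b) s)
    rw [hxt s] at this
    exact this
  -- The weight starts at `c t` for `y = x` and grows just enough that `y t / d t y ≤ b`.
  let d : T → cube T a b → I := fun t y =>
    ⟨max (c t) (y.1 t / b), (c t).2.1.trans (le_max_left _ _),
      max_le (c t).2.2 ((div_le_one hb0).2 (y.2 t).2)⟩
  have hd0 : ∀ t y, (0 : ℝ) < d t y := fun t y => (hc0 t).trans_le (le_max_left _ _)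
  have hdc : ∀ t, Continuous (d t) := fun t => by
    have := continuous_cube_apply (a := a) (b := b) t
    exact Continuous.subtype_mk (by fun_prop) _
  have hdx : ∀ t, d t x = c t := fun t => by
    refine Subtype.ext (max_eq_left ?_)
    rw [div_le_iff₀ hb0, ← hczR t]
    exact mul_le_mul_of_nonneg_left ((z t).2 t).2 (c t).2.1
  -- For `t ∈ S`, the Dirac at `w t y` with weight `d t y` attains `y t` exactly; the minimum keeps
  -- it below `y` elsewhere.
  let w : T → cube T a b → cube T a b := fun t y => clamp ha.le hb hab fun s =>
    if s ∈ S then if s = t then (y.1 s : ℝ) / d t y else min ((z t).1 s : ℝ) (y.1 s / d t y)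
    else y.1 s
  have hwc : ∀ t, Continuous (w t) := fun t => by
    have hdiv : ∀ s, Continuous fun y : cube T a b => (y.1 s : ℝ) / d t y := fun s =>
      (continuous_cube_apply s).div (continuous_subtype_val.comp (hdc t)) fun y => (hd0 t y).ne'
    refine continuous_clamp_comp _ _ _ fun s => ?_
    split_ifs
    · exact hdiv s
    · exact continuous_const.min (hdiv s)
    · exact continuous_cube_apply s
  have hwx : ∀ t, w t x = freeze x S (z t) := fun t => by
    refine Subtype.ext (funext fun s => Subtype.ext ?_)
    have hz : (if s ∈ S then if s = t then (x.1 s : ℝ) / d t x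
        else min ((z t).1 s : ℝ) (x.1 s / d t x) else x.1 s) = (freeze x S (z t)).1 s := by
      rw [freeze_apply, hdx]
      split_ifs with h1 h2
      · rw [h2, ← hczR t, mul_div_cancel_left₀ _ (hc0 t).ne']
      · refine min_eq_left ((le_div_iff₀ (hc0 t)).2 ?_)
        rw [mul_comm]
        exact hcx t s
      · rfl
    refine (clamp_apply_of_mem ha.le hb hab ?_).trans hz
    simp only [hz]
    exact (freeze x S (z t)).2 s
  have hdw : ∀ t y s, (d t y : ℝ) * (w t y).1 s ≤ y.1 s := fun t y s => by
    have h1 : ((w t y).1 s : ℝ) ≤ max a (y.1 s / d t y) := by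
      refine max_le_max le_rfl ((min_le_right _ _).trans ?_)
      beta_reduce
      split_ifs
      · exact le_rfl
      · exact min_le_right _ _
      · exact le_div_self (y.1 s).2.1 (hd0 t y) (d t y).2.2
    have h2 : a ≤ y.1 s / d t y :=
      (y.2 s).1.trans (le_div_self (y.1 s).2.1 (hd0 t y) (d t y).2.2)
    rw [max_eq_right h2, le_div_iff₀ (hd0 t y), mul_comm] at h1
    exact h1
  have hdw_self : ∀ t ∈ S, ∀ y, (d t y : ℝ) * (w t y).1 t = y.1 t := fun t ht y => by
    have h : ((w t y).1 t : ℝ) = y.1 t / d t y := by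
      refine (clamp_apply_of_mem ha.le hb hab ?_).trans (by simp [ht])
      simp only [ht, if_true]
      refine ⟨(y.2 t).1.trans (le_div_self (y.1 t).2.1 (hd0 t y) (d t y).2.2), ?_⟩
      rw [div_le_iff₀ (hd0 t y), ← div_le_iff₀' hb0]
      exact le_max_right _ _
    rw [h, mul_div_cancel₀ _ (hd0 t y).ne']
  -- Coordinates in `S` are only ever shrunk (before clamping), by a factor that brings the
  -- barycenter below `y`.
  let F : C(cube T a b × cube T a b, cube T a b) :=
    ⟨fun p => clamp ha.le hb hab fun s =>
      if s ∈ S then min 1 ((p.1.1 s : ℝ) / x.1 s) * p.2.1 s else p.1.1 s, by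
      refine continuous_clamp_comp _ _ _ fun s => ?_
      have := continuous_cube_apply (a := a) (b := b) s
      split_ifs
      · exact (continuous_const.min ((this.comp continuous_fst).div_const _)).mul
          (this.comp continuous_snd)
      · exact this.comp continuous_fst⟩
  have hFx : F.curry x = freeze x S := by
    refine ContinuousMap.ext fun v => Subtype.ext (funext fun s => Subtype.ext ?_)
    have hz : (if s ∈ S then min 1 ((x.1 s : ℝ) / x.1 s) * v.1 s else x.1 s)
        = (freeze x S v).1 s := by
      rw [freeze_apply, div_self (hpos x s).ne', min_self, one_mul]
      split_ifs <;> rfl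
    change max a (min b (if s ∈ S then min 1 ((x.1 s : ℝ) / x.1 s) * v.1 s else x.1 s)) = _
    rw [hz, min_eq_right ((freeze x S v).2 s).2, max_eq_right ((freeze x S v).2 s).1]
  have hFle : ∀ y s, μ.1 ((coord (cube T a b) s).comp (F.curry y)) ≤ y.1 s := fun y s => by
    let k : I := ⟨min 1 ((y.1 s : ℝ) / x.1 s), le_min zero_le_one
      (div_nonneg (y.1 s).2.1 (x.1 s).2.1), min_le_left _ _⟩
    have hle : (coord (cube T a b) s).comp (F.curry y) ≤
        ContinuousMap.const _ (y.1 s) ⊔ ContinuousMap.const _ k * coord (cube T a b) s :=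
      fun v => by
        change max a (min b (if s ∈ S then min 1 ((y.1 s : ℝ) / x.1 s) * v.1 s else y.1 s)) ≤
          ((y.1 s ⊔ k * v.1 s : I) : ℝ)
        refine max_le ((y.2 s).1.trans (Subtype.coe_le_coe.2 le_sup_left))
          ((min_le_right _ _).trans ?_)
        split_ifs
        · exact Subtype.coe_le_coe.2 (le_sup_right : k * v.1 s ≤ y.1 s ⊔ k * v.1 s)
        · exact Subtype.coe_le_coe.2 le_sup_left
    refine (μ.2.mono hle).trans ?_
    rw [μ.2.map_max, μ.2.map_const, μ.2.map_const_mul, hxt]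
    refine sup_le le_rfl ?_
    change min 1 ((y.1 s : ℝ) / x.1 s) * x.1 s ≤ y.1 s
    calc min 1 ((y.1 s : ℝ) / x.1 s) * x.1 s ≤ (y.1 s : ℝ) / x.1 s * x.1 s :=
          mul_le_mul_of_nonneg_right (min_le_right _ _) (x.1 s).2.1
      _ = y.1 s := div_mul_cancel₀ _ (hpos x s).ne'
  have hFoff : ∀ y, ∀ s ∉ S, μ.1 ((coord (cube T a b) s).comp (F.curry y)) = y.1 s :=
    fun y s hs => by
      have : (coord (cube T a b) s).comp (F.curry y) = ContinuousMap.const _ (y.1 s) := by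
        refine ContinuousMap.ext fun v => Subtype.ext ?_
        change max a (min b (if s ∈ S then min 1 ((y.1 s : ℝ) / x.1 s) * v.1 s else y.1 s)) =
          (y.1 s : ℝ)
        rw [if_neg hs, min_eq_right (y.2 s).2, max_eq_right (y.2 s).1]
      rw [this, μ.2.map_const]
  refine ⟨fun y => ⟨_, (μ.2.map (F.curry y)).sup_dirac S (fun t => d t y) fun t => w t y⟩,
    ?_, ?_, ?_⟩
  · refine Continuous.subtype_mk (continuous_pi fun φ => ?_) _
    refine Continuous.sup ?_ (Continuous.finset_sup_apply fun t _ => ?_)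
    · exact μ.2.continuous.comp ((ContinuousMap.continuous_postcomp φ).comp F.curry.continuous)
    · exact (hdc t).mul (φ.continuous.comp (hwc t))
  · intro y
    funext s
    have hle : ∀ t, d t y * coord (cube T a b) s (w t y) ≤ y.1 s := fun t => hdw t y s
    refine le_antisymm (sup_le (hFle y s) (Finset.sup_le fun t _ => hle t)) ?_
    by_cases hs : s ∈ S
    · refine le_trans ?_ (le_sup_of_le_right (Finset.le_sup hs))
      exact (hdw_self s hs y).ge
    · exact (hFoff y s hs).ge.trans le_sup_left
  · intro φ
    change μ.1 (φ.comp (F.curry x)) ⊔ (S.sup fun t => d t x * φ (w t x)) = _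
    rw [hFx]
    -- At `y = x` the Diracs already lie below the pushforward of `μ`, so they are absorbed.
    refine sup_eq_left.2 (Finset.sup_le fun t _ => ?_)
    rw [hdx, hwx]
    exact hcle t (φ.comp (freeze x S))

end Cube

end MaxDot

theorem proposition4p4 (T : Type*) (a b : ℝ)
    (ha : a ∈ Set.Ioc (0 : ℝ) 1) (hb : b ∈ Set.Ioc (0 : ℝ) 1) :
    IsOpenMap (MaxDot.barycenterMap (MaxDot.cube T a b)
      (MaxDot.barycenterPoint_mem_cube T a b ha hb)) := by
  classical
  rcases lt_or_ge b a with hab | hab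
  · have := MaxDot.subsingleton_cube (T := T) hab
    exact fun _ _ => isOpen_discrete _
  refine IsOpenMap.of_nhds_le fun μ W hW => ?_
  rw [Filter.mem_map] at hW
  set x := MaxDot.barycenterMap (MaxDot.cube T a b)
    (MaxDot.barycenterPoint_mem_cube T a b ha hb) μ with hx
  choose ρ hρc hρb hρx using
    MaxDot.exists_section ha.1 hb.2 hab μ x rfl
  have hlim : Filter.Tendsto (fun S => ρ S x) Filter.atTop (nhds μ) := by
    rw [tendsto_subtype_rng, tendsto_pi_nhds]
    intro φ
    simp only [hρx]
    exact (μ.2.continuous.tendsto φ).comp (MaxDot.tendsto_comp_freeze x φ)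
  obtain ⟨U, hUW, hU, hμU⟩ := mem_nhds_iff.1 hW
  obtain ⟨S, hS⟩ := (hlim.eventually (hU.mem_nhds hμU)).exists
  filter_upwards [(hρc S).continuousAt.preimage_mem_nhds (hU.mem_nhds hS)] with y hy
  have hWy := hUW hy
  rw [Set.mem_preimage] at hWy
  rwa [show MaxDot.barycenterMap (MaxDot.cube T a b)
    (MaxDot.barycenterPoint_mem_cube T a b ha hb) (ρ S y) = y from Subtype.ext (hρb S y)] at hWy
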